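/- Let $X=\{x_0,x_1,\dots,x_m\}$ be a set of noncommuting letters and $\tilde X=\{\tilde x_1,\dots,\tilde x_q\}$ a set of commuting letters. Write $\sqcup\!\sqcup$ for the shuffle product on $\mathbb R\langle\langle X\rangle\rangle$, $\mathbf 1=1\emptyset$, and apply products of vector-valued series componentwise. For $w\in\mathbb R^m\langle\langle X\rangle\rangle$ and $c\in\mathbb R^\ell\langle\langle X\rangle\rangle$ put $$c\,\tilde\circ\,\delta_w=\sum_{\eta\in X^*}(c,\eta)\,\bar\phi_w(\eta)(\mathbf 1),\qquad \bar\phi_w(x_0)(e)=x_0e,\quad \bar\phi_w(x_i)(e)=x_i(w_i\sqcup\!\sqcup e)\ (1\le i\le m),$$ with $\bar\phi_w(\emptyset)=\mathrm{id}$ and $\bar\phi_w(x_i\eta)=\bar\phi_w(x_i)\circ\bar\phi_w(\eta)$. Let $w^{\circ-1}$ denote the series with $\delta_{w^{\circ-1}}=(\delta_w)^{\circ-1}$, the inverse for the product $\delta_a\circ\delta_b=\delta_{b\,\sqcup\!\sqcup\,(a\tilde\circ\delta_b)}$ with identity $\delta_{(\mathbf 1,\dots,\mathbf 1)}$. For $d\in\mathbb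 R^m[[\tilde X]]$ and $c\in\mathbb R^q\langle\langle X\rangle\rangle$ proper (that is, $(c,\emptyset)=0$) put $d\diamond c=\sum_{n\in\mathbb N^q}(d,\tilde x^n)\,c_1^{\sqcup\!\sqcup n_1}\sqcup\!\sqcup\cdots\sqcup\!\sqcup c_q^{\sqcup\!\sqcup n_q}$. Call $d$ purely improper if every component has a nonzero constant term; then $d^{-1}$ is its componentwise Cauchy inverse. A (formal) Chen–Fliess series is $F_c[u]=\sum_{\eta\in X^*}(c,\eta)E_\eta[u]$, with $E_\emptyset[u]=1$, $E_{x_i\eta}[u](t)=\int_{t_0}^t u_i(\tau)E_\eta[u](\tau)\,d\tau$ and $u_0=1$, for inputs $u\in\mathbb R[[t-t_0]]^m$. The formal static map of $d$ is $f_d(z)=\sum_n(d,\tilde x^n)z^n$. **Theorem.** Let $c\in\mathbb R^q\langle\langle X\rangle\rangle$ be proper and let $d\in\mathbb R^m[[\tilde X]]$ be purely improper. Then $\delta_{d^{-1}\diamond c}$ has exactly one inverse for the product $\circ$, so that the multiplicative static feedback product $$c\,\bar@\,d:=c\,\tilde\circ\,\delta_{(d^{-1}\diamond c)^{\circ-1}}\in\mathbb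 R^q\langle\langle X\rangle\rangle$$ is well defined; it is a proper series. For every external input $v\in\mathbb R[[t-t_0]]^m$ the closed loop of $F_c$ in multiplicative output feedback with $f_d$, $$y=F_c[u],\qquad u_i=v_i\,f_d(y)_i\quad(1\le i\le m),$$ has exactly one solution $(u,y)$, and its output is $y=F_{c\bar@d}[v]$. Moreover $c\,\bar@\,d$ is the only series $e\in\mathbb R^q\langle\langle X\rangle\rangle$ with $y=F_e[v]$ for all $v$; that is, $c\,\bar@\,d$ is the generating series of the closed loop. -/

import Mathlib

noncomputable section

namespace ChenFliess

/-- Words over the alphabet `X = {x_0, x_1, …, x_m}`; the letter `x_i` is `i : Fin (m + 1)`. -/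
abbrev Word (m : ℕ) := List (Fin (m + 1))

/-- Real noncommutative formal power series over `X`: arbitrary maps from words to `ℝ`.
A series with coefficients in `ℝ^ℓ` is given by its components, as a map `Fin ℓ → Series m`. -/
abbrev Series (m : ℕ) := Word m → ℝ

/-- A vector-valued series is proper when its coefficient at the empty word is zero. -/
def IsProper {m ℓ : ℕ} (c : Fin ℓ → Series m) : Prop := ∀ i, c i [] = 0

/-! ### Shuffle product -/

/-- The shuffle `ζ ⧢ ν` of two words, as the list (with multiplicities) of the words in the sum
defined by `(xζ) ⧢ (yν) = x(ζ ⧢ yν) + y(xζ ⧢ ν)` and `ζ ⧢ ∅ = ∅ ⧢ ζ = ζ`. -/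
def wordShuffle {α : Type*} : List α → List α → List (List α)
  | [], ν => [ν]
  | x :: ζ, [] => [x :: ζ]
  | x :: ζ, y :: ν =>
      (wordShuffle ζ (y :: ν)).map (x :: ·) ++ (wordShuffle (x :: ζ) ν).map (y :: ·)

/-- All ways to split a word into a subword and the complementary subword. The pair `(ζ, ν)`
occurs in `unshuffles η` as often as `η` occurs in the shuffle of `ζ` and `ν`
(see `count_unshuffles`). -/
def unshuffles {α : Type*} : List α → List (List α × List α)
  | [] => [([], [])]
  | x :: η => (unshuffles η).map (fun p => (x :: p.1, p.2)) ++
      (unshuffles η).map (fun p => (p.1, x :: p.2))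

/-- Shuffle product of two series: the coefficient at `η` is the sum of `(c, ζ) (d, ν)` over all
pairs of words, each pair counted with the multiplicity of `η` in `ζ ⧢ ν`. -/
def shuffle {m : ℕ} (c d : Series m) : Series m :=
  fun η => ((unshuffles η).map (fun p => c p.1 * d p.2)).sum

/-- The series `𝟏 = 1 ∅`. -/
def oneSeries (m : ℕ) : Series m := fun η => if η = [] then 1 else 0

/-- The series `x e` obtained from `e` by prepending the letter `x` to every word. -/
def prepend {m : ℕ} (x : Fin (m + 1)) (e : Series m) : Series m
  | [] => 0
  | y :: η => if y = x then e η else 0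

/-! ### Multiplicative mixed composition product -/

/-- `η ◦̃ δ_w = φ̄_w(η)(𝟏)`, where `φ̄_w(x_0)(e) = x_0 e` and `φ̄_w(x_i)(e) = x_i (w_i ⧢ e)`. -/
def wordMixedComp {m : ℕ} (w : Fin m → Series m) : Word m → Series m
  | [] => oneSeries m
  | x :: η => prepend x
      (Fin.cases (motive := fun _ => Series m) (wordMixedComp w η)
        (fun i => shuffle (w i) (wordMixedComp w η)) x)

/-- Multiplicative mixed composition product `c ◦̃ δ_w = ∑_η (c, η) (η ◦̃ δ_w)`. For every word `ξ`
only finitely many `η` contribute (see `finite_support_mixedComp`). -/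
def mixedComp {m ℓ : ℕ} (c : Fin ℓ → Series m) (w : Fin m → Series m) : Fin ℓ → Series m :=
  fun i ξ => ∑ᶠ η : Word m, c i η * wordMixedComp w η ξ

/-- Multiplicative composition product on the series `δ_w = δ ⧢ w`, with `δ_w` represented by `w`:
`δ_c ∘ δ_d = δ_{d ⧢ (c ◦̃ δ_d)}`, the shuffle product being componentwise. -/
def mulComp {m : ℕ} (c d : Fin m → Series m) : Fin m → Series m :=
  fun i => shuffle (d i) (mixedComp c d i)

/-- `δ_e` is a two-sided inverse of `δ_w` for the multiplicative composition product, whose identity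
element is `δ_𝟙` with `𝟙 = (1, …, 1)`. -/
def IsMulCompInverse {m : ℕ} (w e : Fin m → Series m) : Prop :=
  mulComp w e = (fun _ => oneSeries m) ∧ mulComp e w = (fun _ => oneSeries m)

open Classical in
/-- `w^{∘-1}`: the series with `δ_{w^{∘-1}} = (δ_w)^{∘-1}`, if `δ_w` is invertible for the
multiplicative composition product (and a dummy value otherwise). -/
def mulCompInv {m : ℕ} (w : Fin m → Series m) : Fin m → Series m :=
  if h : ∃ e, IsMulCompInverse w e then h.choose else fun _ => oneSeries m

/-! ### Formal static maps and Wiener-Fliess composition -/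

/-- Generating series in `ℝ^k[[X̃]]` of formal static maps `ℝ^q → ℝ^k`: series in the `q` commuting
letters `X̃ = {x̃_1, …, x̃_q}`, given by their components. -/
abbrev StaticSeries (q k : ℕ) := Fin k → MvPowerSeries (Fin q) ℝ

/-- Every component is non-proper. -/
def IsPurelyImproper {q k : ℕ} (d : StaticSeries q k) : Prop :=
  ∀ i, MvPowerSeries.constantCoeff (d i) ≠ 0

/-- The componentwise Cauchy inverse `d^{-1}`. -/
def cauchyInv {q k : ℕ} (d : StaticSeries q k) : StaticSeries q k := fun i => (d i)⁻¹

/-- The shuffle power `a^{⧢ n}`. -/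
def shufflePow {m : ℕ} (a : Series m) : ℕ → Series m
  | 0 => oneSeries m
  | n + 1 => shuffle a (shufflePow a n)

/-- `c^{⧢ x̃^n}` for the commutative monomial `x̃^n = x̃_1^{n_1} ⋯ x̃_q^{n_q}`: the shuffle product
of the `c_j^{⧢ n_j}`. -/
def monomialShuffle {m q : ℕ} (c : Fin q → Series m) (n : Fin q →₀ ℕ) : Series m :=
  (List.finRange q).foldr (fun j a => shuffle (shufflePow (c j) (n j)) a) (oneSeries m)

/-- Wiener-Fliess composition product `d ⋄ c = ∑_n (d, x̃^n) c^{⧢ x̃^n}`, for a proper series `c`.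
For every word `ξ` only finitely many monomials contribute (see `finite_support_wienerFliess`). -/
def wienerFliess {m q k : ℕ} (d : StaticSeries q k) (c : Fin q → Series m) : Fin k → Series m :=
  fun i ξ => ∑ᶠ n : Fin q →₀ ℕ, MvPowerSeries.coeff n (d i) * monomialShuffle c n ξ

/-- The multiplicative static feedback product `c @̄ d = c ◦̃ δ_{(d^{-1} ⋄ c)^{∘-1}}`. -/
def staticFeedbackProduct {m q : ℕ} (c : Fin q → Series m) (d : StaticSeries q m) :
    Fin q → Series m :=
  mixedComp c (mulCompInv (wienerFliess (cauchyInv d) c))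

/-! ### Formal Chen-Fliess series and the closed loop -/

/-- A formal signal: a formal power series in the time variable `t - t_0`. -/
abbrev Signal := PowerSeries ℝ

/-- Formal integration `f ↦ ∫_{t_0}^t f(τ) dτ`. -/
def integrate (f : Signal) : Signal :=
  PowerSeries.mk fun n => Nat.casesOn n 0 (fun k => PowerSeries.coeff k f / ((k : ℝ) + 1))

/-- The iterated integrals `E_η[u]`: `E_∅[u] = 1` and `E_{x_i η}[u] = ∫ u_i E_η[u]`,
with `u_0 = 1`. -/
def iterInt {m : ℕ} (u : Fin m → Signal) : Word m → Signal
  | [] => 1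
  | x :: η => integrate (Fin.cases (motive := fun _ => Signal) 1 u x * iterInt u η)

/-- The formal Chen-Fliess series `F_c[u] = ∑_η (c, η) E_η[u]`. For every power of `t - t_0` only
finitely many words contribute (see `finite_support_fliess`). -/
def fliess {m ℓ : ℕ} (c : Fin ℓ → Series m) (u : Fin m → Signal) : Fin ℓ → Signal :=
  fun i => PowerSeries.mk fun n => ∑ᶠ η : Word m, c i η * PowerSeries.coeff n (iterInt u η)

/-- The formal static map `f_d(z) = ∑_n (d, x̃^n) z^n`, applied to a vector of formal signals with
zero constant terms. -/
def staticMap {q k : ℕ} (d : StaticSeries q k) (y : Fin q → Signal) : Fin k → Signal :=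
  fun i => MvPowerSeries.subst (τ := Unit) (S := ℝ) y (d i)

/-- The closed loop of the plant `F_c` in multiplicative output feedback with `f_d`: with external
input `v`, plant input `u` and output `y`, it is described by `y = F_c[u]` and `u = v f_d(y)`
(componentwise product). -/
def IsClosedLoop {m q : ℕ} (c : Fin q → Series m) (d : StaticSeries q m)
    (v u : Fin m → Signal) (y : Fin q → Signal) : Prop :=
  y = fliess c u ∧ u = v * staticMap d y

/-- `e` is a generating series of the closed loop: for every external input `v`, the output of the
closed loop is `F_e[v]`. Here the closed loop is required to be well posed, i.e. to have exactly
one solution `(u, y)` for each `v`. -/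
def IsClosedLoopGeneratingSeries {m q : ℕ} (c : Fin q → Series m) (d : StaticSeries q m)
    (e : Fin q → Series m) : Prop :=
  ∀ v : Fin m → Signal,
    (∃! p : (Fin m → Signal) × (Fin q → Signal), IsClosedLoop c d v p.1 p.2) ∧
    ∀ u y, IsClosedLoop c d v u y → y = fliess e v

/-! ### The finiteness and multiplicity facts that the definitions rely on -/

theorem count_unshuffles {α : Type*} [DecidableEq α] (η ζ ν : List α) :
    (unshuffles η).count (ζ, ν) = (wordShuffle ζ ν).count η := by
  have hcons (x : α) (l : List (List α)) (η : List α) (y : α) :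
      (l.map (x :: ·)).count (y :: η) = if x = y then l.count η else 0 := by
    split_ifs with h
    · subst h
      exact List.count_map_of_injective _ _ List.cons_injective _
    · refine List.count_eq_zero_of_not_mem fun hm => ?_
      obtain ⟨_, _, he⟩ := List.mem_map.1 hm
      exact h (List.cons.inj he).1
  have hnil (x : α) (l : List (List α)) : (l.map (x :: ·)).count [] = 0 :=
    List.count_eq_zero_of_not_mem fun hm => by simp at hm
  have hl (x : α) (l : List (List α × List α)) (ζ ν : List α) :
      (l.map (fun p => (x :: p.1, p.2))).count (ζ, ν) =
        match ζ with
        | [] => 0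
        | y :: ζ => if x = y then l.count (ζ, ν) else 0 := by
    cases ζ with
    | nil => exact List.count_eq_zero_of_not_mem fun hm => by simp at hm
    | cons y ζ =>
      dsimp only
      split_ifs with h
      · subst h
        exact List.count_map_of_injective l (fun p : List α × List α => (x :: p.1, p.2))
          (fun p q h => by simpa [Prod.ext_iff] using h) (ζ, ν)
      · exact List.count_eq_zero_of_not_mem fun hm => by simp [h] at hm
  have hr (x : α) (l : List (List α × List α)) (ζ ν : List α) :
      (l.map (fun p => (p.1, x :: p.2))).count (ζ, ν) =
        match ν with
        | [] => 0
        | y :: ν => if x = y then l.count (ζ, ν) else 0 := by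
    cases ν with
    | nil => exact List.count_eq_zero_of_not_mem fun hm => by simp at hm
    | cons y ν =>
      dsimp only
      split_ifs with h
      · subst h
        exact List.count_map_of_injective l (fun p : List α × List α => (p.1, x :: p.2))
          (fun p q h => by simpa [Prod.ext_iff] using h) (ζ, ν)
      · exact List.count_eq_zero_of_not_mem fun hm => by simp [h] at hm
  induction η generalizing ζ ν with
  | nil =>
    cases ζ <;> cases ν <;> simp [unshuffles, wordShuffle, List.count_append, hnil]
  | cons a η ih =>
    rw [unshuffles, List.count_append, hl, hr]
    cases ζ with
    | nil =>
      cases ν with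
      | nil => simp [wordShuffle]
      | cons y ν =>
        simp only [ih, wordShuffle, zero_add]
        exact (hcons y [ν] η a).symm ▸ if_congr eq_comm rfl rfl
    | cons x ζ =>
      cases ν with
      | nil =>
        have : wordShuffle ζ [] = [ζ] := by cases ζ <;> simp [wordShuffle]
        simp only [ih, wordShuffle, this, add_zero]
        exact (hcons x [ζ] η a).symm ▸ if_congr eq_comm rfl rfl
      | cons y ν =>
        simp only [ih, wordShuffle, List.count_append, hcons, eq_comm]

theorem length_of_mem_unshuffles {α : Type*} {η : List α} {p : List α × List α}
    (h : p ∈ unshuffles η) : p.1.length + p.2.length = η.length := by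
  induction η generalizing p with
  | nil => simp_all [unshuffles]
  | cons a η ih =>
    simp only [unshuffles, List.mem_append, List.mem_map] at h
    rcases h with ⟨r, hr, rfl⟩ | ⟨r, hr, rfl⟩ <;> have := ih hr <;> simp <;> omega

theorem shuffle_eq_zero {m : ℕ} {a b : Series m} {k l : ℕ}
    (ha : ∀ ζ : Word m, ζ.length < k → a ζ = 0) (hb : ∀ ν : Word m, ν.length < l → b ν = 0)
    (ξ : Word m) (hξ : ξ.length < k + l) : shuffle a b ξ = 0 := by
  refine List.sum_eq_zero fun r hr => ?_
  obtain ⟨p, hp, rfl⟩ := List.mem_map.1 hr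
  have := length_of_mem_unshuffles hp
  rcases lt_or_ge p.1.length k with h | h
  · simp [ha _ h]
  · simp [hb p.2 (by omega)]

theorem wordMixedComp_eq_zero {m : ℕ} (w : Fin m → Series m) (η ξ : Word m)
    (h : ξ.length < η.length) : wordMixedComp w η ξ = 0 := by
  induction η generalizing ξ with
  | nil => simp at h
  | cons x η ih =>
    cases ξ with
    | nil => rfl
    | cons y ξ =>
      simp only [wordMixedComp, prepend]
      split_ifs
      · have h' : ξ.length < η.length := by simpa using h
        cases x using Fin.cases with
        | zero => exact ih ξ h'
        | succ i => exact shuffle_eq_zero (k := 0) (by simp) (fun ν hν => ih ν hν) ξ (by simpa)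
      · rfl

theorem finite_support_mixedComp {m : ℕ} (a : Series m) (w : Fin m → Series m) (ξ : Word m) :
    (Function.support fun η : Word m => a η * wordMixedComp w η ξ).Finite := by
  refine (List.finite_length_le (Fin (m + 1)) ξ.length).subset fun η hη => ?_
  by_contra hlt
  exact hη (by simp [wordMixedComp_eq_zero w η ξ (by simpa using hlt)])

theorem monomialShuffle_eq_zero {m q : ℕ} {c : Fin q → Series m} (hc : IsProper c)
    (n : Fin q →₀ ℕ) (ξ : Word m) (h : ξ.length < n.degree) : monomialShuffle c n ξ = 0 := by
  have hp (j : Fin q) (k : ℕ) (ζ : Word m) (hζ : ζ.length < k) : shufflePow (c j) k ζ = 0 := by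
    induction k generalizing ζ with
    | zero => simp at hζ
    | succ k ih =>
      refine shuffle_eq_zero (k := 1) (l := k) (fun η hη => ?_) ih ζ (by omega)
      rw [List.length_eq_zero_iff.1 (Nat.lt_one_iff.1 hη)]
      exact hc j
  have hf (L : List (Fin q)) (ζ : Word m) (hζ : ζ.length < (L.map n).sum) :
      L.foldr (fun j a => shuffle (shufflePow (c j) (n j)) a) (oneSeries m) ζ = 0 := by
    induction L generalizing ζ with
    | nil => simp at hζ
    | cons j L ih => exact shuffle_eq_zero (hp j (n j)) ih ζ (by simpa using hζ)
  refine hf _ ξ ?_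
  rwa [← List.ofFn_eq_map, List.sum_ofFn, ← Finsupp.degree_eq_sum]

theorem finite_support_wienerFliess {m q : ℕ} (f : MvPowerSeries (Fin q) ℝ) {c : Fin q → Series m}
    (hc : IsProper c) (ξ : Word m) :
    (Function.support fun n : Fin q →₀ ℕ =>
      MvPowerSeries.coeff n f * monomialShuffle c n ξ).Finite := by
  refine (Finsupp.finite_of_degree_le ξ.length).subset fun n hn => ?_
  by_contra hlt
  exact hn (by simp [monomialShuffle_eq_zero hc n ξ (by simpa using hlt)])

theorem coeff_iterInt_eq_zero {m : ℕ} (u : Fin m → Signal) (η : Word m) (n : ℕ)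
    (h : n < η.length) : PowerSeries.coeff n (iterInt u η) = 0 := by
  induction η generalizing n with
  | nil => simp at h
  | cons x η ih =>
    rw [iterInt, integrate, PowerSeries.coeff_mk]
    cases n with
    | zero => rfl
    | succ n =>
      have : PowerSeries.coeff n
          (Fin.cases (motive := fun _ => Signal) 1 u x * iterInt u η) = 0 := by
        rw [PowerSeries.coeff_mul]
        refine Finset.sum_eq_zero fun p hp => ?_
        have := Finset.HasAntidiagonal.mem_antidiagonal.1 hp
        simp only [List.length_cons] at h
        rw [ih p.2 (by omega), mul_zero]
      simp [this]

theorem finite_support_fliess {m : ℕ} (a : Series m) (u : Fin m → Signal) (n : ℕ) :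
    (Function.support fun η : Word m => a η * PowerSeries.coeff n (iterInt u η)).Finite := by
  refine (List.finite_length_le (Fin (m + 1)) n).subset fun η hη => ?_
  by_contra hlt
  exact hη (by simp [coeff_iterInt_eq_zero u η n (by simpa using hlt)])

/-- For a proper plant the static map is only ever applied where the substitution is defined. -/
theorem hasSubst_of_isClosedLoop {m q : ℕ} {c : Fin q → Series m} (hc : IsProper c)
    {d : StaticSeries q m} {v u : Fin m → Signal} {y : Fin q → Signal}
    (h : IsClosedLoop c d v u y) : MvPowerSeries.HasSubst (τ := Unit) (S := ℝ) y := by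
  refine MvPowerSeries.hasSubst_of_constantCoeff_zero fun i => ?_
  have : PowerSeries.constantCoeff (y i) = 0 := by
    rw [h.1, ← PowerSeries.coeff_zero_eq_constantCoeff_apply, fliess, PowerSeries.coeff_mk]
    refine finsum_eq_zero_of_forall_eq_zero fun η => ?_
    cases η with
    | nil => simp [hc i]
    | cons x η => rw [coeff_iterInt_eq_zero u _ _ (by simp), mul_zero]
  exact this

end ChenFliess

end

noncomputable section

namespace ChenFliess

open PowerSeries Filter Topology

variable {m : ℕ}

/-! Every series is studied through its action on formal inputs. Under `a ↦ F_a` the shuffle product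
becomes the product of signals, `c ◦̃ δ_w` becomes `v ↦ F_c[v F_w[v]]` (`fliess_mixedComp`), and `d
⋄ c` becomes `f_d(F_c[u])` (`fliess_wienerFliess`). Thus `δ_w` acts as the input transformation `v ↦
v F_w[v]`, and `∘` is composition of such transformations.

Since `a ↦ F_a` is injective on formal inputs (`fliess_injective`), identities between series can be
checked on signals; associativity and the unit laws for `∘` follow this way. Injectivity comes from
adding `(t - t_0)^K` to one input and letting `K → ∞`: integration divides by numbers of size `K`,
so the iterated integrals change negligibly and the summand with the bare factor `u_i` is isolated.
When all constant terms of `w` are nonzero, a right inverse of `δ_w` is a fixed point of a map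
contracting in word length (`exists_mulComp_eq_one`), and the monoid laws make it the unique
two-sided inverse.

For the loop, put `w = d^{-1} ⋄ c`. Then `F_w[u] f_d(F_c[u]) = 1`, so `u = v f_d(F_c[u])` is
equivalent to `u F_w[u] = v`, hence to `u = v F_{w^{∘-1}}[v]` (`isClosedLoop_iff`). This gives the
unique solution, with output `F_c[v F_{w^{∘-1}}[v]] = F_{c @̄ d}[v]`; injectivity makes the
generating series unique. -/

/-! ### Coefficients and derivatives of formal Chen-Fliess series -/

/-- The inputs `u_0 = 1, u_1, …, u_m`, indexed by the letters. -/
def extInput (u : Fin m → Signal) (x : Fin (m + 1)) : Signal :=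
  Fin.cases (motive := fun _ => Signal) 1 u x

@[simp] theorem extInput_zero (u : Fin m → Signal) : extInput u 0 = 1 := rfl

@[simp] theorem extInput_succ (u : Fin m → Signal) (i : Fin m) : extInput u i.succ = u i := rfl

/-- The Chen-Fliess series of a scalar generating series. -/
def fliessScalar (a : Series m) (u : Fin m → Signal) : Signal :=
  PowerSeries.mk fun n => ∑ᶠ η : Word m, a η * coeff n (iterInt u η)

theorem fliess_apply {ℓ : ℕ} (c : Fin ℓ → Series m) (u : Fin m → Signal) (i : Fin ℓ) :
    fliess c u i = fliessScalar (c i) u := rfl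

/-- The left quotient `x⁻¹ a`. -/
def leftQuot (x : Fin (m + 1)) (a : Series m) : Series m := fun η => a (x :: η)

/-- The words of length at most `n`. -/
def wordsLE (m n : ℕ) : Finset (Word m) := (List.finite_length_le (Fin (m + 1)) n).toFinset

@[simp] theorem mem_wordsLE {n : ℕ} {η : Word m} : η ∈ wordsLE m n ↔ η.length ≤ n := by
  simp [wordsLE]

theorem sum_wordsLE_succ (n : ℕ) (g : Word m → ℝ) :
    ∑ η ∈ wordsLE m (n + 1), g η = g [] + ∑ x, ∑ η ∈ wordsLE m n, g (x :: η) := by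
  classical
  have h : wordsLE m (n + 1) = insert [] ((Finset.univ ×ˢ wordsLE m n).image
      fun p : Fin (m + 1) × Word m => p.1 :: p.2) := by
    ext η
    cases η <;> simp
  rw [h, Finset.sum_insert (by simp), Finset.sum_image (by
    rintro ⟨x, η⟩ _ ⟨y, ν⟩ _ h
    simpa using h), Finset.sum_product]

theorem coeff_fliessScalar (a : Series m) (u : Fin m → Signal) {n N : ℕ} (h : n ≤ N) :
    coeff n (fliessScalar a u) = ∑ η ∈ wordsLE m N, a η * coeff n (iterInt u η) := by
  rw [fliessScalar, coeff_mk]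
  refine finsum_eq_sum_of_support_subset _ fun η hη => ?_
  by_contra hlt
  exact hη (by simp [coeff_iterInt_eq_zero u η n (by simp at hlt; omega)])

theorem coeff_mul_fliessScalar (g : Signal) (a : Series m) (u : Fin m → Signal) {n N : ℕ}
    (h : n ≤ N) :
    coeff n (g * fliessScalar a u) = ∑ η ∈ wordsLE m N, a η * coeff n (g * iterInt u η) := by
  simp only [coeff_mul, Finset.mul_sum]
  rw [Finset.sum_comm]
  refine Finset.sum_congr rfl fun p hp => ?_
  have := Finset.HasAntidiagonal.mem_antidiagonal.1 hp
  rw [coeff_fliessScalar a u (show p.2 ≤ N by omega), Finset.mul_sum]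
  exact Finset.sum_congr rfl fun η _ => by ring

@[simp] theorem constantCoeff_integrate (f : Signal) : constantCoeff (integrate f) = 0 := by
  rw [← coeff_zero_eq_constantCoeff_apply, integrate, coeff_mk]; rfl

@[simp] theorem derivative_integrate (f : Signal) : derivative ℝ (integrate f) = f := by
  ext n
  rw [coeff_derivative, integrate, coeff_mk]
  field_simp

theorem iterInt_cons (u : Fin m → Signal) (x : Fin (m + 1)) (η : Word m) :
    iterInt u (x :: η) = integrate (extInput u x * iterInt u η) := rfl

@[simp] theorem constantCoeff_fliessScalar (a : Series m) (u : Fin m → Signal) :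
    constantCoeff (fliessScalar a u) = a [] := by
  have h : wordsLE m 0 = {[]} := by ext; simp
  rw [← coeff_zero_eq_constantCoeff_apply, coeff_fliessScalar a u le_rfl, h]
  simp [iterInt]

/-- Differentiation strips the outermost integral, `E_{xη}' = u_x E_η`, so left quotients take the
role of derivatives. Both the shuffle formula and injectivity rest on this recursion. -/
theorem derivative_fliessScalar (a : Series m) (u : Fin m → Signal) :
    derivative ℝ (fliessScalar a u) = ∑ x, extInput u x * fliessScalar (leftQuot x a) u := by
  ext n
  simp only [map_sum, coeff_mul_fliessScalar _ _ u (le_refl n)]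
  rw [coeff_derivative, coeff_fliessScalar a u le_rfl, sum_wordsLE_succ, add_mul, Finset.sum_mul]
  have h0 : coeff (n + 1) (iterInt u []) = 0 := by simp [iterInt, coeff_one]
  rw [h0, mul_zero, zero_mul, zero_add]
  refine Finset.sum_congr rfl fun x _ => ?_
  rw [Finset.sum_mul]
  refine Finset.sum_congr rfl fun η _ => ?_
  rw [mul_assoc, ← coeff_derivative, iterInt_cons, derivative_integrate, leftQuot]

theorem fliessScalar_add (a b : Series m) (u : Fin m → Signal) :
    fliessScalar (a + b) u = fliessScalar a u + fliessScalar b u := by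
  ext n
  simp [coeff_fliessScalar _ u (le_refl n), add_mul, Finset.sum_add_distrib]

theorem fliessScalar_sub (a b : Series m) (u : Fin m → Signal) :
    fliessScalar (a - b) u = fliessScalar a u - fliessScalar b u := by
  ext n
  simp [coeff_fliessScalar _ u (le_refl n), sub_mul, Finset.sum_sub_distrib]

theorem fliessScalar_smul (r : ℝ) (a : Series m) (u : Fin m → Signal) :
    fliessScalar (r • a) u = r • fliessScalar a u := by
  ext n
  simp [coeff_fliessScalar _ u (le_refl n), Finset.mul_sum, mul_assoc]

@[simp] theorem fliessScalar_zero (u : Fin m → Signal) :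
    fliessScalar (0 : Series m) u = 0 := by
  ext n
  simp [coeff_fliessScalar _ u (le_refl n)]

@[simp] theorem fliessScalar_oneSeries (u : Fin m → Signal) :
    fliessScalar (oneSeries m) u = 1 := by
  have h (x : Fin (m + 1)) : leftQuot x (oneSeries m) = 0 := by ext η; simp [leftQuot, oneSeries]
  refine derivative.ext ?_ ?_
  · simp [derivative_fliessScalar, h]
  · simp [oneSeries]

theorem fliessScalar_prepend (x : Fin (m + 1)) (e : Series m) (u : Fin m → Signal) :
    fliessScalar (prepend x e) u = integrate (extInput u x * fliessScalar e u) := by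
  have h (y : Fin (m + 1)) : leftQuot y (prepend x e) = if y = x then e else 0 := by
    ext η
    simp only [leftQuot, prepend]
    split_ifs <;> rfl
  refine derivative.ext ?_ ?_
  · rw [derivative_fliessScalar, derivative_integrate, Finset.sum_eq_single x] <;>
      simp +contextual [h]
  · simp [prepend]

/-! ### Products and compositions of series as operations on signals -/

/-- The first letter of a word goes to one of the two factors, which is the Leibniz rule for left
quotients. -/
theorem leftQuot_shuffle (x : Fin (m + 1)) (a b : Series m) :
    leftQuot x (shuffle a b) = shuffle (leftQuot x a) b + shuffle a (leftQuot x b) := by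
  ext η
  simp [leftQuot, shuffle, unshuffles, Function.comp_def]

/-- The Chen-Fliess series of a shuffle product is the product of the Chen-Fliess series. -/
theorem fliessScalar_shuffle (a b : Series m) (u : Fin m → Signal) :
    fliessScalar (shuffle a b) u = fliessScalar a u * fliessScalar b u := by
  ext n
  induction n using Nat.strong_induction_on generalizing a b with
  | _ n ih =>
    cases n with
    | zero => simp [shuffle, unshuffles]
    | succ n =>
      -- Both sides obey the same Leibniz recursion, and coefficient `n` of the derivatives involves
      -- only coefficients up to `n` for the pairs with one left quotient taken, which the induction
      -- covers.
      have hd : coeff n (derivative ℝ (fliessScalar (shuffle a b) u)) =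
          coeff n (derivative ℝ (fliessScalar a u * fliessScalar b u)) := by
        rw [Derivation.leibniz]
        simp only [derivative_fliessScalar, leftQuot_shuffle, fliessScalar_add, smul_eq_mul,
          Finset.mul_sum, ← Finset.sum_add_distrib]
        rw [map_sum, map_sum]
        refine Finset.sum_congr rfl fun x _ => ?_
        rw [show fliessScalar a u * (extInput u x * fliessScalar (leftQuot x b) u) +
            fliessScalar b u * (extInput u x * fliessScalar (leftQuot x a) u) =
            extInput u x * (fliessScalar (leftQuot x a) u * fliessScalar b u +
              fliessScalar a u * fliessScalar (leftQuot x b) u) by ring, coeff_mul, coeff_mul]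
        refine Finset.sum_congr rfl fun p hp => ?_
        have := Finset.HasAntidiagonal.mem_antidiagonal.1 hp
        rw [map_add, map_add, ih p.2 (by omega), ih p.2 (by omega)]
      rw [coeff_derivative, coeff_derivative] at hd
      exact mul_right_cancel₀ (by positivity) hd

theorem fliessScalar_wordMixedComp (w : Fin m → Series m) (η : Word m) (v : Fin m → Signal) :
    fliessScalar (wordMixedComp w η) v = iterInt (v * fliess w v) η := by
  induction η with
  | nil => simp [wordMixedComp, iterInt]
  | cons x η ih =>
    rw [wordMixedComp, fliessScalar_prepend, iterInt_cons, ← ih]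
    cases x using Fin.cases with
    | zero => simp
    | succ i => simp [fliessScalar_shuffle, fliess_apply, mul_assoc]

/-- Both compositions are locally finite sums: the indices in `S n` account for all words of length
at most `n`, and only those words affect coefficient `n`. This permits exchanging `F` with the sum.
-/
theorem fliessScalar_eq_of_finite {ι : Type*} (S : ℕ → Finset ι) (f : ι → ℝ) (g : ι → Series m)
    (a : Series m) (u : Fin m → Signal)
    (ha : ∀ n ξ, ξ.length ≤ n → a ξ = ∑ j ∈ S n, f j * g j ξ) (n : ℕ) :
    coeff n (fliessScalar a u) = ∑ j ∈ S n, f j * coeff n (fliessScalar (g j) u) := by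
  simp only [coeff_fliessScalar _ u (le_refl n), Finset.mul_sum]
  rw [Finset.sum_comm]
  refine Finset.sum_congr rfl fun ξ hξ => ?_
  rw [ha n ξ (by simpa using hξ), Finset.sum_mul]
  exact Finset.sum_congr rfl fun η _ => by ring

/-- Mixed composition corresponds to composition with `v ↦ v F_w[v]`. -/
theorem fliess_mixedComp {ℓ : ℕ} (c : Fin ℓ → Series m) (w : Fin m → Series m)
    (v : Fin m → Signal) : fliess (mixedComp c w) v = fliess c (v * fliess w v) := by
  funext i
  ext n
  rw [fliess_apply, fliess_apply, coeff_fliessScalar (c i) _ (le_refl n),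
    fliessScalar_eq_of_finite (wordsLE m) (c i) (wordMixedComp w)]
  · simp only [fliessScalar_wordMixedComp]
  · intro n ξ hξ
    refine finsum_eq_sum_of_support_subset _ fun η hη => ?_
    by_contra hlt
    exact hη (by simp [wordMixedComp_eq_zero w η ξ (by simp at hlt; omega)])

theorem fliess_mulComp (a b : Fin m → Series m) (v : Fin m → Signal) :
    fliess (mulComp a b) v = fliess b v * fliess a (v * fliess b v) := by
  rw [← fliess_mixedComp]
  funext i
  exact fliessScalar_shuffle _ _ v

theorem fliess_one (v : Fin m → Signal) :
    fliess (fun _ : Fin m => oneSeries m) v = 1 :=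
  funext fun _ => fliessScalar_oneSeries v

theorem fliessScalar_shufflePow (a : Series m) (n : ℕ) (u : Fin m → Signal) :
    fliessScalar (shufflePow a n) u = fliessScalar a u ^ n := by
  induction n with
  | zero => simp [shufflePow]
  | succ n ih => rw [shufflePow, fliessScalar_shuffle, ih, pow_succ']

theorem fliessScalar_monomialShuffle {q : ℕ} (c : Fin q → Series m) (n : Fin q →₀ ℕ)
    (u : Fin m → Signal) :
    fliessScalar (monomialShuffle c n) u = ∏ j, fliess c u j ^ n j := by
  have h (L : List (Fin q)) : fliessScalar
      (L.foldr (fun j a => shuffle (shufflePow (c j) (n j)) a) (oneSeries m)) u =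
      (L.map fun j => fliess c u j ^ n j).prod := by
    induction L with
    | nil => simp
    | cons j L ih =>
      rw [List.foldr_cons, fliessScalar_shuffle, ih, fliessScalar_shufflePow, List.map_cons,
        List.prod_cons, fliess_apply]
  rw [monomialShuffle, h, ← List.ofFn_eq_map, List.prod_ofFn]

theorem hasSubst_fliess {q : ℕ} {c : Fin q → Series m} (hc : IsProper c) (u : Fin m → Signal) :
    MvPowerSeries.HasSubst (τ := Unit) (S := ℝ) (fliess c u) :=
  MvPowerSeries.hasSubst_of_constantCoeff_zero fun i =>
    (constantCoeff_fliessScalar (c i) u).trans (hc i)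

/-- Wiener-Fliess composition corresponds to composition with the formal static map. -/
theorem fliess_wienerFliess {q k : ℕ} (d : StaticSeries q k) {c : Fin q → Series m}
    (hc : IsProper c) (u : Fin m → Signal) :
    fliess (wienerFliess d c) u = staticMap d (fliess c u) := by
  funext i
  ext n
  have hf (n : ℕ) := Finsupp.finite_of_degree_le (σ := Fin q) n
  have key := fliessScalar_eq_of_finite (fun n => (hf n).toFinset)
    (fun e => MvPowerSeries.coeff e (d i)) (monomialShuffle c) (wienerFliess d c i) u
    (fun n ξ hξ => by
      refine finsum_eq_sum_of_support_subset _ fun e he => ?_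
      by_contra hlt
      exact he (by simp [monomialShuffle_eq_zero hc e ξ (by simp at hlt; omega)])) n
  rw [fliess_apply, key, staticMap, PowerSeries.coeff,
    MvPowerSeries.coeff_subst (hasSubst_fliess hc u)]
  symm
  have hp (e : Fin q →₀ ℕ) : (e.prod fun s k => fliess c u s ^ k) =
      fliessScalar (monomialShuffle c e) u := by
    rw [fliessScalar_monomialShuffle, Finsupp.prod_fintype _ _ (by simp)]
  simp only [hp, smul_eq_mul]
  refine finsum_eq_sum_of_support_subset _ fun e he => ?_
  by_contra hlt
  refine he ?_
  have : coeff n (fliessScalar (monomialShuffle c e) u) = 0 := by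
    rw [coeff_fliessScalar _ _ (le_refl n)]
    refine Finset.sum_eq_zero fun ξ hξ => ?_
    rw [monomialShuffle_eq_zero hc e ξ (by simp at hlt hξ; omega), zero_mul]
  exact mul_eq_zero_of_right _ this

/-! ### Injectivity of the map from series to formal input-output operators -/

/-- The input `u` with `(t - t_0)^K` added to its `i`-th component. -/
def bump (u : Fin m → Signal) (i : Fin m) (K : ℕ) : Fin m → Signal :=
  u + Pi.single i (X ^ K)

theorem extInput_bump (u : Fin m → Signal) (i : Fin m) (K : ℕ) (x : Fin (m + 1)) :
    extInput (bump u i K) x = extInput u x + X ^ K * (if x = i.succ then 1 else 0) := by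
  cases x using Fin.cases with
  | zero => simp [(Fin.succ_ne_zero i).symm]
  | succ j =>
    by_cases h : j = i
    · subst h; simp [bump]
    · simp [bump, h]

/-- The change of `E_η` under `bump`. -/
def iterIntDiff (u : Fin m → Signal) (i : Fin m) (η : Word m) (K : ℕ) : Signal :=
  iterInt (bump u i K) η - iterInt u η

theorem derivative_iterIntDiff_cons (u : Fin m → Signal) (i : Fin m) (x : Fin (m + 1))
    (η : Word m) (K : ℕ) :
    derivative ℝ (iterIntDiff u i (x :: η) K) = extInput u x * iterIntDiff u i η K +
      X ^ K * ((if x = i.succ then 1 else 0) * iterInt (bump u i K) η) := by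
  rw [iterIntDiff, map_sub, iterInt_cons, iterInt_cons, derivative_integrate,
    derivative_integrate, extInput_bump, iterIntDiff]
  ring

/-- The perturbation starts in degree `K`, and each of the integrations raises the order by one. -/
theorem coeff_iterIntDiff_eq_zero (u : Fin m → Signal) (i : Fin m) (η : Word m) (K n : ℕ)
    (h : n < K + η.length) : coeff n (iterIntDiff u i η K) = 0 := by
  induction η generalizing n with
  | nil => simp [iterIntDiff, iterInt]
  | cons x η ih =>
    cases n with
    | zero => simp [iterIntDiff, iterInt_cons]
    | succ n =>
      rw [List.length_cons] at h
      have hd : coeff n (derivative ℝ (iterIntDiff u i (x :: η) K)) = 0 := by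
        rw [derivative_iterIntDiff_cons, map_add, coeff_mul, Finset.sum_eq_zero, zero_add,
          coeff_X_pow_mul']
        · split_ifs
          · rw [one_mul, coeff_iterInt_eq_zero _ _ _ (by omega)]
          · simp
          · rfl
        · intro p hp
          have := Finset.HasAntidiagonal.mem_antidiagonal.1 hp
          rw [ih p.2 (by omega), mul_zero]
      rw [coeff_derivative] at hd
      exact (mul_eq_zero.1 hd).resolve_right (by positivity)

/-- Factoring `X ^ K` out of `D K` leaves a convolution whose number of terms depends on `r` alone,
so the limit can be taken termwise. -/
theorem tendsto_coeff_mul {D : ℕ → Signal} (hD : ∀ K n, n < K → coeff n (D K) = 0)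
    (hlim : ∀ r, Tendsto (fun K => coeff (K + r) (D K)) atTop (𝓝 0)) (g : Signal) (r : ℕ) :
    Tendsto (fun K => coeff (K + r) (g * D K)) atTop (𝓝 0) := by
  have h (K : ℕ) : coeff (K + r) (g * D K) =
      ∑ p ∈ Finset.HasAntidiagonal.antidiagonal r, coeff p.1 g * coeff (K + p.2) (D K) := by
    obtain ⟨G, hG⟩ := X_pow_dvd_iff.2 (hD K)
    rw [hG, mul_left_comm, add_comm K r, coeff_X_pow_mul, coeff_mul]
    exact Finset.sum_congr rfl fun p _ => by rw [add_comm K, coeff_X_pow_mul]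
  simp only [h]
  rw [← Finset.sum_const_zero (s := Finset.HasAntidiagonal.antidiagonal r)]
  refine tendsto_finsetSum _ fun p _ => ?_
  simpa using (hlim p.2).const_mul (coeff p.1 g)

/-- The outermost integration divides a convergent numerator by `K + s + 1`. The offset `r` is fixed
while `K` grows, so this divisor tends to infinity. -/
theorem tendsto_coeff_iterIntDiff (u : Fin m → Signal) (i : Fin m) (η : Word m) (r : ℕ) :
    Tendsto (fun K => coeff (K + r) (iterIntDiff u i η K)) atTop (𝓝 0) := by
  induction η generalizing r with
  | nil => simp [iterIntDiff, iterInt]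
  | cons x η ih =>
    cases r with
    | zero => simp [coeff_iterIntDiff_eq_zero]
    | succ s =>
      have h (K : ℕ) : coeff (K + (s + 1)) (iterIntDiff u i (x :: η) K) =
          (coeff (K + s) (extInput u x * iterIntDiff u i η K) +
            coeff s ((if x = i.succ then 1 else 0) * iterInt (bump u i K) η)) /
              ((K + s : ℕ) + 1 : ℝ) := by
        rw [eq_div_iff (by positivity), ← add_assoc, ← coeff_derivative,
          derivative_iterIntDiff_cons, map_add, add_comm K s, coeff_X_pow_mul]
      simp only [h]
      refine Tendsto.div_atTop
        (a := 0 + coeff s ((if x = i.succ then 1 else 0) * iterInt u η)) ?_ ?_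
      · refine (tendsto_coeff_mul (fun K n hn => coeff_iterIntDiff_eq_zero u i η K n (by omega))
          ih _ s).add (tendsto_const_nhds.congr' ?_)
        -- Once `K > s` the bump no longer affects coefficient `s`, so this term is eventually
        -- constant.
        filter_upwards [eventually_gt_atTop s] with K hK
        have := coeff_iterIntDiff_eq_zero u i η K s (by omega)
        rw [iterIntDiff, map_sub, sub_eq_zero] at this
        split_ifs
        · rw [one_mul, one_mul, this]
        · simp
      · exact tendsto_atTop_add_const_right _ _
          (tendsto_natCast_atTop_atTop.comp (tendsto_add_atTop_nat s))

theorem coeff_fliessScalar_bump_sub (a : Series m) (u : Fin m → Signal) (i : Fin m) (K n : ℕ) :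
    coeff n (fliessScalar a (bump u i K) - fliessScalar a u) =
      ∑ η ∈ wordsLE m n, a η * coeff n (iterIntDiff u i η K) := by
  rw [map_sub, coeff_fliessScalar _ _ le_rfl, coeff_fliessScalar _ _ le_rfl,
    ← Finset.sum_sub_distrib]
  simp [iterIntDiff, mul_sub]

theorem coeff_fliessScalar_bump_sub_eq_zero (a : Series m) (u : Fin m → Signal) (i : Fin m)
    (K n : ℕ) (h : n < K) : coeff n (fliessScalar a (bump u i K) - fliessScalar a u) = 0 := by
  rw [coeff_fliessScalar_bump_sub]
  refine Finset.sum_eq_zero fun η _ => ?_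
  rw [coeff_iterIntDiff_eq_zero _ _ _ _ _ (by omega), mul_zero]

theorem tendsto_coeff_fliessScalar_bump_sub (a : Series m) (u : Fin m → Signal) (i : Fin m)
    (r : ℕ) : Tendsto (fun K => coeff (K + r) (fliessScalar a (bump u i K) - fliessScalar a u))
      atTop (𝓝 0) := by
  have h (K : ℕ) : coeff (K + r) (fliessScalar a (bump u i K) - fliessScalar a u) =
      ∑ η ∈ wordsLE m r, a η * coeff (K + r) (iterIntDiff u i η K) := by
    rw [coeff_fliessScalar_bump_sub]
    symm
    -- Words longer than `r` start contributing only beyond degree `K + r`, so the range of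
    -- summation is independent of `K`.
    refine Finset.sum_subset (fun η => by simp; omega) fun η _ hη => ?_
    rw [coeff_iterIntDiff_eq_zero _ _ _ _ _ (by simp at hη; omega), mul_zero]
  simp only [h]
  rw [← Finset.sum_const_zero (s := wordsLE m r)]
  refine tendsto_finsetSum _ fun η _ => ?_
  simpa using (tendsto_coeff_iterIntDiff u i η r).const_mul (a η)

/-- If `∑ x, u_x F_{a_x}[u]` vanishes for all inputs, then so does each `F_{a_x}[u]`. -/
theorem fliessScalar_eq_zero_of_sum (a : Fin (m + 1) → Series m)
    (h : ∀ u : Fin m → Signal, ∑ x, extInput u x * fliessScalar (a x) u = 0)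
    (x : Fin (m + 1)) (u : Fin m → Signal) : fliessScalar (a x) u = 0 := by
  have hsucc (i : Fin m) (u : Fin m → Signal) : fliessScalar (a i.succ) u = 0 := by
    ext r
    -- This is the hypothesis at the bumped input minus the hypothesis at `u`. In degree `K + r` the
    -- differences vanish in the limit, while the last summand tends to coefficient `r` of the
    -- `F`-series attached to the letter `x_i`.
    have hK (K : ℕ) : ∑ x, extInput u x *
        (fliessScalar (a x) (bump u i K) - fliessScalar (a x) u) +
          X ^ K * fliessScalar (a i.succ) (bump u i K) = 0 := by
      have h1 := h (bump u i K)
      simp only [extInput_bump, add_mul, Finset.sum_add_distrib, mul_assoc, ite_mul, one_mul,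
        zero_mul, mul_ite, mul_zero, Finset.sum_ite_eq', Finset.mem_univ, if_true] at h1
      simp only [mul_sub, Finset.sum_sub_distrib, h u, sub_zero, h1]
    have hlim : Tendsto (fun K => coeff (K + r) (∑ x, extInput u x *
        (fliessScalar (a x) (bump u i K) - fliessScalar (a x) u)) +
          coeff r (fliessScalar (a i.succ) (bump u i K))) atTop
        (𝓝 (0 + coeff r (fliessScalar (a i.succ) u))) := by
      refine Tendsto.add ?_ (tendsto_const_nhds.congr' ?_)
      · simp only [map_sum]
        rw [← Finset.sum_const_zero (s := (Finset.univ : Finset (Fin (m + 1))))]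
        exact tendsto_finsetSum _ fun x _ => tendsto_coeff_mul
          (coeff_fliessScalar_bump_sub_eq_zero (a x) u i)
          (tendsto_coeff_fliessScalar_bump_sub (a x) u i) _ r
      · filter_upwards [eventually_gt_atTop r] with K hrK
        have := coeff_fliessScalar_bump_sub_eq_zero (a i.succ) u i K r hrK
        rw [map_sub, sub_eq_zero] at this
        exact this.symm
    have hzero : (fun K => coeff (K + r) (∑ x, extInput u x *
        (fliessScalar (a x) (bump u i K) - fliessScalar (a x) u)) +
          coeff r (fliessScalar (a i.succ) (bump u i K))) = fun _ => (0 : ℝ) := by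
      funext K
      have := congrArg (coeff (K + r)) (hK K)
      rwa [map_add, add_comm K r, coeff_X_pow_mul, add_comm r K, map_zero] at this
    rw [hzero, zero_add] at hlim
    exact tendsto_nhds_unique hlim tendsto_const_nhds
  cases x using Fin.cases with
  | succ i => exact hsucc i u
  -- The letter `x_0` cannot be perturbed, but it is the only one left and `u_0 = 1`.
  | zero =>
    have := h u
    rwa [Fin.sum_univ_succ, Finset.sum_eq_zero fun i _ => by rw [hsucc, mul_zero], add_zero,
      extInput_zero, one_mul] at this

theorem eq_zero_of_fliessScalar_eq_zero (a : Series m)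
    (h : ∀ u : Fin m → Signal, fliessScalar a u = 0) : a = 0 := by
  ext η
  induction η generalizing a with
  | nil => simpa using (constantCoeff_fliessScalar a 0).symm.trans (by rw [h 0, map_zero])
  | cons x η ih =>
    -- The derivative of `F_a[u] = 0` is a vanishing sum `∑ u_x F_{x⁻¹a}[u]`, so every left quotient
    -- again has zero Chen-Fliess series.
    refine ih (leftQuot x a) (fliessScalar_eq_zero_of_sum (fun x => leftQuot x a) (fun u => ?_) x)
    rw [← derivative_fliessScalar, h u, map_zero]

theorem fliessScalar_injective {a b : Series m}
    (h : ∀ u : Fin m → Signal, fliessScalar a u = fliessScalar b u) : a = b :=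
  sub_eq_zero.1 (eq_zero_of_fliessScalar_eq_zero _ fun u => by
    rw [fliessScalar_sub, h u, sub_self])

/-- A series is determined by its Chen-Fliess series on formal inputs. -/
theorem fliess_injective {ℓ : ℕ} {a b : Fin ℓ → Series m}
    (h : ∀ u : Fin m → Signal, fliess a u = fliess b u) : a = b :=
  funext fun i => fliessScalar_injective fun u => congrFun (h u) i

/-! ### The monoid of multiplicative compositions and its inverses -/

theorem mulComp_assoc (a b c : Fin m → Series m) :
    mulComp (mulComp a b) c = mulComp a (mulComp b c) :=
  fliess_injective fun v => by simp only [fliess_mulComp, mul_assoc]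

theorem one_mulComp (a : Fin m → Series m) : mulComp (fun _ => oneSeries m) a = a :=
  fliess_injective fun v => by rw [fliess_mulComp, fliess_one, mul_one]

theorem mulComp_one (a : Fin m → Series m) : mulComp a (fun _ => oneSeries m) = a :=
  fliess_injective fun v => by rw [fliess_mulComp, fliess_one, mul_one, one_mul]

/-- Agreement of two families of series on the words of length less than `n`. -/
def AgreeBelow (n : ℕ) (e e' : Fin m → Series m) : Prop :=
  ∀ i ξ, ξ.length < n → e i ξ = e' i ξ

/-- This is Banach's fixed point argument in the word-length ultrametric. -/
theorem exists_fixedPoint_of_agreeBelow (Φ : (Fin m → Series m) → Fin m → Series m)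
    (hΦ : ∀ n e e', AgreeBelow n e e' → AgreeBelow (n + 1) (Φ e) (Φ e')) : ∃ e, Φ e = e := by
  have hit (n : ℕ) (e e' : Fin m → Series m) : AgreeBelow n (Φ^[n] e) (Φ^[n] e') := by
    induction n with
    | zero => intro i ξ h; simp at h
    | succ n ih => simpa only [Function.iterate_succ_apply'] using hΦ _ _ _ ih
  -- The iterates have stabilised at words of length `k` after `k + 1` steps.
  let e : Fin m → Series m := fun i ξ => Φ^[ξ.length + 1] 0 i ξ
  have he (n : ℕ) : AgreeBelow n e (Φ^[n] 0) := by
    intro i ξ h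
    obtain ⟨k, rfl⟩ := Nat.exists_eq_add_of_le (Nat.succ_le_of_lt h)
    rw [Function.iterate_add_apply]
    exact hit (ξ.length + 1) 0 _ i ξ (Nat.lt_succ_self _)
  refine ⟨e, funext fun i => funext fun ξ => ?_⟩
  rw [hΦ _ _ _ (he ξ.length) i ξ (Nat.lt_succ_self _), ← Function.iterate_succ_apply' Φ]

theorem shuffle_congr {a a' b b' : Series m} (ξ : Word m)
    (h : ∀ p ∈ unshuffles ξ, a p.1 * b p.2 = a' p.1 * b' p.2) :
    shuffle a b ξ = shuffle a' b' ξ :=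
  congrArg List.sum (List.map_congr_left h)

/-- Each factor `w_i` enters behind a letter `x_i`, so agreement below length `n` yields agreement
up to and including length `n`. This gain of one is the source of the contraction. -/
theorem wordMixedComp_congr {n : ℕ} {w w' : Fin m → Series m} (h : AgreeBelow n w w')
    (η ξ : Word m) (hξ : ξ.length ≤ n) : wordMixedComp w η ξ = wordMixedComp w' η ξ := by
  induction η generalizing ξ with
  | nil => rfl
  | cons x η ih =>
    cases ξ with
    | nil => rfl
    | cons y ξ =>
      rw [List.length_cons] at hξ
      simp only [wordMixedComp, prepend]
      split_ifs
      · cases x using Fin.cases with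
        | zero => exact ih ξ (by omega)
        | succ i =>
          refine shuffle_congr ξ fun p hp => ?_
          have := length_of_mem_unshuffles hp
          rw [h i p.1 (by omega), ih p.2 (by omega)]
      · rfl

theorem mixedComp_congr {n ℓ : ℕ} (c : Fin ℓ → Series m) {w w' : Fin m → Series m}
    (h : AgreeBelow n w w') (i : Fin ℓ) (ξ : Word m) (hξ : ξ.length ≤ n) :
    mixedComp c w i ξ = mixedComp c w' i ξ :=
  finsum_congr fun η => by rw [wordMixedComp_congr h η ξ hξ]

theorem mixedComp_nil {ℓ : ℕ} (c : Fin ℓ → Series m) (w : Fin m → Series m) (i : Fin ℓ) :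
    mixedComp c w i [] = c i [] := by
  have h := congrArg (fun f => PowerSeries.constantCoeff (f i)) (fliess_mixedComp c w 0)
  simpa only [fliess_apply, constantCoeff_fliessScalar] using h

theorem shuffle_sub_smul_one (a b : Series m) (r : ℝ) :
    shuffle a (b - r • oneSeries m) = shuffle a b - r • a :=
  fliessScalar_injective fun u => by
    simp only [fliessScalar_shuffle, fliessScalar_sub, fliessScalar_smul, fliessScalar_oneSeries,
      mul_sub, mul_smul_comm, mul_one]

/-- The equation `e_i ⧢ (w ◦̃ δ_e)_i = 𝟏` is solved for the leading part of `e_i` by splitting off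
the constant term `w_i(∅)` of the second factor. -/
theorem exists_mulComp_eq_one {w : Fin m → Series m} (hw : ∀ i, w i [] ≠ 0) :
    ∃ e, mulComp w e = fun _ => oneSeries m := by
  obtain ⟨e, he⟩ := exists_fixedPoint_of_agreeBelow (fun e i => (w i [])⁻¹ •
    (oneSeries m - shuffle (e i) (mixedComp w e i - w i [] • oneSeries m))) (by
      intro n e e' h i ξ hξ
      simp only [Pi.smul_apply, Pi.sub_apply]
      congr 2
      refine shuffle_congr ξ fun p hp => ?_
      have hl := length_of_mem_unshuffles hp
      simp only [Pi.sub_apply]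
      rw [mixedComp_congr w h i p.2 (by omega)]
      -- With the constant term removed, the second factor vanishes at the empty word, so `e` is
      -- never needed at the full word. Otherwise `p.1` is strictly shorter than `ξ`.
      by_cases h2 : p.2 = []
      · simp [h2, mixedComp_nil, oneSeries]
      · have := List.length_pos_iff.2 h2
        rw [h i p.1 (by omega)])
  refine ⟨e, funext fun i => ?_⟩
  have h := congrArg (w i [] • ·) (congrFun he i)
  simp only [smul_inv_smul₀ (hw i), shuffle_sub_smul_one] at h
  rw [mulComp]
  linear_combination (exp := 1) -h

theorem existsUnique_isMulCompInverse {w : Fin m → Series m} (hw : ∀ i, w i [] ≠ 0) :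
    ∃! e, IsMulCompInverse w e := by
  obtain ⟨e, he⟩ := exists_mulComp_eq_one hw
  have hmul (a b : Fin m → Series m) (i : Fin m) : mulComp a b i [] = b i [] * a i [] := by
    simp [mulComp, shuffle, unshuffles, mixedComp_nil]
  -- Constant terms multiply to one, so those of `e` are nonzero and `e` has a right inverse too; a
  -- right inverse `f` of a right inverse `e` of `w` must equal `w`.
  obtain ⟨f, hf⟩ := exists_mulComp_eq_one (w := e) fun i h0 => by
    have h := congrFun (congrFun he i) []
    rw [hmul, h0] at h
    simp [oneSeries] at h
  have hfw : w = f := by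
    rw [← mulComp_one w, ← hf, ← mulComp_assoc, he, one_mulComp]
  refine ⟨e, ⟨he, hfw ▸ hf⟩, fun e' he' => ?_⟩
  rw [← mulComp_one e', ← he, ← mulComp_assoc, he'.2, one_mulComp]

theorem isMulCompInverse_mulCompInv {w : Fin m → Series m} (h : ∃ e, IsMulCompInverse w e) :
    IsMulCompInverse w (mulCompInv w) := by
  rw [mulCompInv, dif_pos h]
  exact h.choose_spec

/-! ### Solution of the closed loop -/

/-- Inverses for `∘` give inverse input transformations. -/
theorem mul_fliess_eq_iff {w e : Fin m → Series m} (h : IsMulCompInverse w e)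
    (u v : Fin m → Signal) : u * fliess w u = v ↔ u = v * fliess e v := by
  have key {a b : Fin m → Series m} (hab : mulComp a b = fun _ => oneSeries m)
      (v : Fin m → Signal) : v * fliess b v * fliess a (v * fliess b v) = v := by
    rw [mul_assoc, ← fliess_mulComp, hab, fliess_one, mul_one]
  constructor
  · rintro rfl
    exact (key h.2 u).symm
  · rintro rfl
    exact key h.1 v

/-- Substituting the constant-free signals `F_c[u]` is an algebra homomorphism, so it carries
`d^{-1} d = 1` to signals. -/
theorem fliess_wienerFliess_cauchyInv_mul {q : ℕ} {c : Fin q → Series m} (hc : IsProper c)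
    {d : StaticSeries q m} (hd : IsPurelyImproper d) (u : Fin m → Signal) :
    fliess (wienerFliess (cauchyInv d) c) u * staticMap d (fliess c u) = 1 := by
  rw [fliess_wienerFliess _ hc]
  funext i
  have hs := hasSubst_fliess hc u
  refine (MvPowerSeries.subst_mul hs _ _).symm.trans ?_
  rw [cauchyInv, MvPowerSeries.inv_mul_cancel _ (hd i), ← MvPowerSeries.coe_substAlgHom hs,
    map_one]
  rfl

theorem wienerFliess_cauchyInv_nil_ne_zero {q : ℕ} {c : Fin q → Series m} (hc : IsProper c)
    {d : StaticSeries q m} (hd : IsPurelyImproper d) (i : Fin m) :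
    wienerFliess (cauchyInv d) c i [] ≠ 0 := by
  intro h0
  have h := congrArg (fun f => PowerSeries.constantCoeff (f i))
    (fliess_wienerFliess_cauchyInv_mul hc hd 0)
  simp [fliess_apply, h0] at h

/-- Multiplication by `F_{d^{-1} ⋄ c}[u]`, the reciprocal of `f_d(F_c[u])`, turns the implicit
feedback equation into `u F_{d^{-1} ⋄ c}[u] = v`, which `e` solves explicitly. -/
theorem isClosedLoop_iff {q : ℕ} {c : Fin q → Series m} (hc : IsProper c)
    {d : StaticSeries q m} (hd : IsPurelyImproper d) {e : Fin m → Series m}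
    (he : IsMulCompInverse (wienerFliess (cauchyInv d) c) e) (v u : Fin m → Signal)
    (y : Fin q → Signal) :
    IsClosedLoop c d v u y ↔ u = v * fliess e v ∧ y = fliess c u := by
  have hinv := fliess_wienerFliess_cauchyInv_mul hc hd u
  rw [IsClosedLoop, and_comm, and_congr_left_iff]
  rintro rfl
  rw [← mul_fliess_eq_iff he]
  constructor
  · intro h
    calc _ = v * (fliess (wienerFliess (cauchyInv d) c) u * staticMap d (fliess c u)) := by
          nth_rw 1 [h]; ring
      _ = v := by rw [hinv, mul_one]
  · rintro rfl
    rw [mul_assoc, hinv, mul_one]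

end ChenFliess

end

theorem mainTheorem6 {m q : ℕ} (c : Fin q → ChenFliess.Series m) (hc : ChenFliess.IsProper c)
    (d : ChenFliess.StaticSeries q m) (hd : ChenFliess.IsPurelyImproper d) :
    (∃! w : Fin m → ChenFliess.Series m, ChenFliess.IsMulCompInverse
      (ChenFliess.wienerFliess (ChenFliess.cauchyInv d) c) w) ∧
    ChenFliess.IsProper (ChenFliess.staticFeedbackProduct c d) ∧
    ∀ e : Fin q → ChenFliess.Series m,
      ChenFliess.IsClosedLoopGeneratingSeries c d e ↔
        e = ChenFliess.staticFeedbackProduct c d := by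
  have hex := ChenFliess.existsUnique_isMulCompInverse
    (ChenFliess.wienerFliess_cauchyInv_nil_ne_zero hc hd)
  refine ⟨hex, fun i => (ChenFliess.mixedComp_nil _ _ i).trans (hc i), fun e => ?_⟩
  have hinv := ChenFliess.isMulCompInverse_mulCompInv hex.exists
  have hloop := ChenFliess.isClosedLoop_iff hc hd hinv
  constructor
  · intro h
    -- The explicit loop solution forces `F_e[v]` to be its output for every `v`, which determines
    -- `e`.
    refine ChenFliess.fliess_injective fun v => ?_
    rw [ChenFliess.staticFeedbackProduct, ChenFliess.fliess_mixedComp]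
    exact ((h v).2 _ _ ((hloop v _ _).2 ⟨rfl, rfl⟩)).symm
  · rintro rfl v
    refine ⟨⟨(_, ChenFliess.fliess c _), (hloop v _ _).2 ⟨rfl, rfl⟩, ?_⟩, ?_⟩
    · rintro ⟨u, y⟩ h
      obtain ⟨rfl, rfl⟩ := (hloop v u y).1 h
      rfl
    · intro u y h
      obtain ⟨rfl, rfl⟩ := (hloop v u y).1 h
      rw [ChenFliess.staticFeedbackProduct, ChenFliess.fliess_mixedComp]
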